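/- **Setting.** Let $(I,\mathbb A,m)$ be a measure space with $m(I)<\infty$ and write $|Q|=m(Q)$. Let $\mathcal P=(\mathcal P^k)_{k\ge 0}$ be a $(\lambda_1,\lambda_2)$-good grid with $0<\lambda_1<\lambda_2<1$, that is: each $\mathcal P^k$ is a finite family of measurable sets of positive measure, at least one of the families is non-empty, the number of elements of $\mathcal P^k$ that meet a given $Q\in\mathcal P^k$ is bounded uniformly in $k$ and $Q$, and no set belongs to two different levels; $\mathcal P^0=\{I\}$; for every $k$ the elements of $\mathcal P^k$ are pairwise disjoint and cover $I$ up to a null set; every $Q\in\mathcal P^{k+1}$ is contained in some $R\in\mathcal P^k$; $\lambda_1\le |Q|/|R|\le\lambda_2$ whenever $Q\subset R$, $Q\in\mathcal P^{k+1}$, $R\in\mathcal P^k$; and $\bigcup_k\mathcal P^k$ generates the $\sigma$-algebra $\mathbb A$. Let $p\in[1,\infty)$, $q\in[1,\infty]$ and $0<s<1/p$. For $Q\in\bigcup_k\mathcal P^k$, an $(s,p)$-Souza atom on $Q$ is a function $a\colon I\to\mathbb C$ that vanishes off $Q$, is constant on $Q$, and satisfies $|a|_\infty\le|Q|^{s-1/p}$.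 The space $\mathcal B^s_{p,q}$ consists of all complex-valued $f\in L^p(m)$ that have a representation $$f=\sum_{k=0}^\infty\sum_{Q\in\mathcal P^k}c_Qa_Q,\qquad c_Q\in\mathbb C,\quad a_Q \text{ an } (s,p)\text{-Souza atom on } Q,$$ where the series over $k$ converges absolutely in $L^p$ (that is, $\sum_k\big|\sum_{Q\in\mathcal P^k}c_Qa_Q\big|_p<\infty$) and the cost $\big(\sum_k(\sum_{Q\in\mathcal P^k}|c_Q|^p)^{q/p}\big)^{1/q}$ is finite; $|f|_{\mathcal B^s_{p,q}}$ is the infimum of the costs of all such representations of $f$. Moreover let $$osc_p(f,Q)=\inf_{c\in\mathbb C}\Big(\int_Q|f-c|^p\,dm\Big)^{1/p},\qquad osc^s_{p,q}(f)=\Big(\sum_k\big(\sum_{Q\in\mathcal P^k}|Q|^{-sp}\,osc_p(f,Q)^p\big)^{q/p}\Big)^{1/q}\in[0,\infty].$$ For $q=\infty$ the outer $\ell^q$ norm over $k$ is replaced by a supremum. **Proposition 19.1.** Let $g\colon\mathbb C\to\mathbb C$ be Lipschitz with constant $K$ and $g(0)=0$. Then the left composition $L_g\colon\mathcal B^s_{p,q}\to\mathcal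 B^s_{p,q}$, $L_g(f)=g\circ f$, is well defined (it respects equality almost everywhere, and $f\in\mathcal B^s_{p,q}$ implies $g\circ f\in\mathcal B^s_{p,q}$), and for every $f\in L^p(m)$, in particular for every $f\in\mathcal B^s_{p,q}$, $$|g\circ f|_p+osc^s_{p,q}(g\circ f)\le K\big(|f|_p+osc^s_{p,q}(f)\big)$$ (in $[0,\infty]$, with $0\cdot\infty=0$). Consequently there is a finite constant $C$ such that $$|L_g(f)|_{\mathcal B^s_{p,q}}\le C\,|f|_{\mathcal B^s_{p,q}}\qquad\text{for every } f\in\mathcal B^s_{p,q}.$$ -/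

import Mathlib

open MeasureTheory Filter Topology
open scoped ENNReal NNReal

namespace BesovGrid

variable {I : Type*} [MeasurableSpace I]

/-- A grid: a sequence `P 0, P 1, …` of finite families of measurable sets of positive measure,
at least one of them nonempty, with bounded multiplicity inside each level, and such that
different levels have no member in common. -/
structure IsGrid (m : Measure I) (P : ℕ → Finset (Set I)) : Prop where
  measurableSet : ∀ k, ∀ Q ∈ P k, MeasurableSet Q
  measure_pos : ∀ k, ∀ Q ∈ P k, 0 < m Q
  exists_nonempty : ∃ k, (P k).Nonempty
  multiplicity : ∃ N : ℕ, ∀ k, ∀ Q ∈ P k, {R | R ∈ P k ∧ (R ∩ Q).Nonempty}.ncard ≤ N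
  levels_ne : ∀ i j, i ≠ j → ∀ Q ∈ P i, ∀ R ∈ P j, Q ≠ R

/-- A `(l₁, l₂)`-good grid. -/
structure IsGoodGrid (m : Measure I) (P : ℕ → Finset (Set I)) (l₁ l₂ : ℝ) : Prop
    extends IsGrid m P where
  pos : 0 < l₁
  lt : l₁ < l₂
  lt_one : l₂ < 1
  level_zero : P 0 = {Set.univ}
  cover : ∀ k, m (⋃ Q ∈ P k, Q)ᶜ = 0
  disjoint : ∀ k, ∀ Q ∈ P k, ∀ R ∈ P k, Q ≠ R → Disjoint Q R
  nested : ∀ k, ∀ Q ∈ P (k + 1), ∃ R ∈ P k, Q ⊆ R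
  ratio : ∀ k, ∀ R ∈ P k, ∀ Q ∈ P (k + 1), Q ⊆ R →
    l₁ ≤ m.real Q / m.real R ∧ m.real Q / m.real R ≤ l₂
  generate : ‹MeasurableSpace I› = MeasurableSpace.generateFrom {Q | ∃ k, Q ∈ P k}

/-- The `ℓ^q` norm of a sequence in `[0, ∞]`, with the supremum for `q = ∞`. -/
noncomputable def lqNorm (q : ℝ≥0∞) (x : ℕ → ℝ≥0∞) : ℝ≥0∞ :=
  if q = ∞ then ⨆ k, x k else (∑' k, x k ^ q.toReal) ^ (1 / q.toReal)

/-- The set of `(s, p)`-Souza atoms supported on `Q`: functions that vanish off `Q`, are constant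
on `Q` and are bounded by `|Q| ^ (s - 1 / p)`. -/
def souzaAtoms (m : Measure I) (s p : ℝ) (Q : Set I) : Set (I → ℂ) :=
  {a | (∀ x, x ∉ Q → a x = 0) ∧ (∀ x ∈ Q, ∀ y ∈ Q, a x = a y) ∧
    ∀ x, ‖a x‖ ≤ m.real Q ^ (s - 1 / p)}

/-- The cost `(∑_k (∑_{Q ∈ P k} |c_Q|^p)^{q/p})^{1/q}` of a family of coefficients. -/
noncomputable def cost (P : ℕ → Finset (Set I)) (p : ℝ) (q : ℝ≥0∞) (c : Set I → ℂ) : ℝ≥0∞ :=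
  lqNorm q fun k => (∑ Q ∈ P k, ‖c Q‖ₑ ^ p) ^ (1 / p)

/-- `f = ∑_k ∑_{Q ∈ P k} c_Q a_Q` is a representation of `f` by Souza atoms: the series (over `k`)
converges absolutely in `L^p`, its sum is `f`, and the cost is finite (here `1 ≤ p < ∞`). -/
structure IsRepresentation (m : Measure I) (P : ℕ → Finset (Set I)) (s p : ℝ) (q : ℝ≥0∞)
    (f : I → ℂ) (c : Set I → ℂ) (a : Set I → I → ℂ) : Prop where
  atom : ∀ k, ∀ Q ∈ P k, a Q ∈ souzaAtoms m s p Q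
  summable : ∑' k, eLpNorm (fun x => ∑ Q ∈ P k, c Q * a Q x) (ENNReal.ofReal p) m < ∞
  tendsto : Tendsto (fun n => eLpNorm
    (fun x => f x - ∑ k ∈ Finset.range n, ∑ Q ∈ P k, c Q * a Q x) (ENNReal.ofReal p) m)
    atTop (𝓝 0)
  cost_lt_top : cost P p q c < ∞

/-- `f` belongs to the Besov space `𝓑^s_{p,q}` of the grid `P`. -/
def MemBesov (m : Measure I) (P : ℕ → Finset (Set I)) (s p : ℝ) (q : ℝ≥0∞) (f : I → ℂ) : Prop :=
  MemLp f (ENNReal.ofReal p) m ∧ ∃ c a, IsRepresentation m P s p q f c a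

/-- The norm `|f|_{𝓑^s_{p,q}}`: the infimum of the costs of all representations of `f`. -/
noncomputable def besovNorm (m : Measure I) (P : ℕ → Finset (Set I)) (s p : ℝ) (q : ℝ≥0∞)
    (f : I → ℂ) : ℝ≥0∞ :=
  sInf {t | ∃ c a, IsRepresentation m P s p q f c a ∧ t = cost P p q c}

/-- The local mean oscillation `osc_p(f, Q) = inf_c (∫_Q |f - c|^p dm)^{1/p}`. -/
noncomputable def osc (m : Measure I) (p : ℝ) (f : I → ℂ) (Q : Set I) : ℝ≥0∞ :=
  ⨅ c : ℂ, (∫⁻ x in Q, ‖f x - c‖ₑ ^ p ∂m) ^ (1 / p)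

/-- `osc^s_{p,q}(f) = (∑_k (∑_{Q ∈ P k} |Q|^{-sp} osc_p(f, Q)^p)^{q/p})^{1/q}`. -/
noncomputable def oscNorm (m : Measure I) (P : ℕ → Finset (Set I)) (s p : ℝ) (q : ℝ≥0∞)
    (f : I → ℂ) : ℝ≥0∞ :=
  lqNorm q fun k => (∑ Q ∈ P k, m Q ^ (-(s * p)) * osc m p f Q ^ p) ^ (1 / p)

end BesovGrid

/-! The quantity `|f|_p + osc^s_{p,q}(f)` is equivalent to the Besov norm on `L^p`, and composition
with a Lipschitz map handles it trivially: if `b` competes in the infimum for `f` on a cell, then `g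
b` competes for `g ∘ f`, at cost at most `K` times larger.

From atoms to oscillation (`IsRepresentation.eLpNorm_le`, `IsRepresentation.oscNorm_le`): the
partial sum through level `k` is constant on the cells of level `k`, so only finer levels oscillate
there. Since `|Q|` shrinks by a factor `l₂` per level, the contribution from `j` levels below decays
like `l₂ ^ (s j)`, and Minkowski in `ℓ^q` sums the geometric series.

From oscillation to atoms (`IsGoodGrid.exists_isRepresentation`): expand `f` in differences of
averages over a cell and over its parent. Such a difference is bounded by the oscillation on the
parent, with a loss `l₁ ^ (-s)`.

Applying the first direction to `f`, the Lipschitz bound, then the second to `g ∘ f` gives a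
constant independent of `f` and of its representation. -/

namespace BesovGrid

/-! ### Sequence norms with values in `[0, ∞]`. -/

theorem lqNorm_eq_eLpNorm {q : ℝ≥0∞} (hq : 1 ≤ q) (x : ℕ → ℝ≥0∞) :
    lqNorm q x = eLpNorm x q Measure.count := by
  unfold lqNorm
  split_ifs with h
  · subst h
    simp [eLpNormEssSup_eq_iSup]
  · rw [eLpNorm_eq_lintegral_rpow_enorm_toReal (by positivity) h, lintegral_count]
    simp

theorem lqNorm_mono {q : ℝ≥0∞} {x y : ℕ → ℝ≥0∞} (h : ∀ k, x k ≤ y k) :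
    lqNorm q x ≤ lqNorm q y := by
  unfold lqNorm
  split_ifs
  · exact iSup_mono h
  · gcongr with k
    exact h k

theorem lqNorm_const_mul {q : ℝ≥0∞} (hq : 1 ≤ q) (a : ℝ≥0∞) (x : ℕ → ℝ≥0∞) :
    lqNorm q (fun k => a * x k) = a * lqNorm q x := by
  unfold lqNorm
  split_ifs with h
  · rw [ENNReal.mul_iSup]
  · have h0 : 0 < q.toReal := ENNReal.toReal_pos (by positivity) h
    simp_rw [ENNReal.mul_rpow_of_nonneg _ _ h0.le, ENNReal.tsum_mul_left]
    rw [ENNReal.mul_rpow_of_nonneg _ _ (by positivity), ← ENNReal.rpow_mul,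
      mul_one_div_cancel h0.ne', ENNReal.rpow_one]

theorem le_lqNorm {q : ℝ≥0∞} (hq : 1 ≤ q) (x : ℕ → ℝ≥0∞) (k : ℕ) : x k ≤ lqNorm q x := by
  unfold lqNorm
  split_ifs with h
  · exact le_iSup x k
  · have h0 : 0 < q.toReal := ENNReal.toReal_pos (by positivity) h
    rw [one_div, ENNReal.le_rpow_inv_iff h0]
    exact ENNReal.le_tsum (f := fun k => x k ^ q.toReal) k

theorem lqNorm_comp_add_right_le {q : ℝ≥0∞} (x : ℕ → ℝ≥0∞) (j : ℕ) :
    lqNorm q (fun k => x (k + j)) ≤ lqNorm q x := by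
  unfold lqNorm
  split_ifs with h
  · exact iSup_comp_le x (fun k => k + j)
  · refine ENNReal.rpow_le_rpow ?_ (by positivity)
    exact ENNReal.tsum_comp_le_tsum_of_injective (add_left_injective j) (fun k => x k ^ q.toReal)

/-- Subadditivity of `t ↦ t ^ (1 / q)`. It isolates the root cell, whose coefficient is controlled
by `|f|_p` and not by an oscillation. -/
theorem lqNorm_le_zero_add_succ {q : ℝ≥0∞} (hq : 1 ≤ q) (x : ℕ → ℝ≥0∞) :
    lqNorm q x ≤ x 0 + lqNorm q (fun k => x (k + 1)) := by
  unfold lqNorm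
  split_ifs with h
  · refine iSup_le fun k => ?_
    cases k with
    | zero => exact le_self_add
    | succ k => exact le_add_left (le_iSup (fun k => x (k + 1)) k)
  · have h1 : 1 ≤ q.toReal := by
      rw [← ENNReal.toReal_one]; exact ENNReal.toReal_mono h hq
    have h0 : 0 < q.toReal := by positivity
    rw [tsum_eq_zero_add' ENNReal.summable]
    refine (ENNReal.rpow_add_le_add_rpow _ _ (by positivity)
      ((div_le_one h0).2 h1)).trans_eq ?_
    rw [← ENNReal.rpow_mul, mul_one_div_cancel h0.ne', ENNReal.rpow_one]

theorem lqNorm_sum_le {q : ℝ≥0∞} (hq : 1 ≤ q) (x : ℕ → ℕ → ℝ≥0∞) (s : Finset ℕ) :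
    lqNorm q (fun k => ∑ j ∈ s, x j k) ≤ ∑ j ∈ s, lqNorm q (x j) := by
  simp_rw [lqNorm_eq_eLpNorm hq]
  rw [show (fun k => ∑ j ∈ s, x j k) = ∑ j ∈ s, x j by ext k; simp]
  exact eLpNorm_sum_le (fun i _ => Measurable.of_discrete.aestronglyMeasurable) hq

/-- Countable Minkowski. For `q < ∞`, restrict to finitely many `k` and let the finite inequality
pass to the limit in `n`. -/
theorem lqNorm_tsum_le {q : ℝ≥0∞} (hq : 1 ≤ q) (x : ℕ → ℕ → ℝ≥0∞) :
    lqNorm q (fun k => ∑' j, x j k) ≤ ∑' j, lqNorm q (x j) := by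
  have key : ∀ n, lqNorm q (fun k => ∑ j ∈ Finset.range n, x j k) ≤ ∑' j, lqNorm q (x j) :=
    fun n => (lqNorm_sum_le hq x _).trans (ENNReal.sum_le_tsum _)
  rcases eq_or_ne q ∞ with h | h
  · subst h
    simp only [lqNorm, if_true]
    exact iSup_le fun k => ENNReal.tsum_le_tsum fun j => le_iSup (x j) k
  · have h0 : 0 < q.toReal := ENNReal.toReal_pos (by positivity) h
    simp only [lqNorm, if_neg h, one_div, ENNReal.rpow_inv_le_iff h0] at key ⊢
    rw [ENNReal.tsum_eq_iSup_sum]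
    refine iSup_le fun t => ?_
    have hlim : Tendsto (fun n => ∑ k ∈ t, (∑ j ∈ Finset.range n, x j k) ^ q.toReal) atTop
        (𝓝 (∑ k ∈ t, (∑' j, x j k) ^ q.toReal)) :=
      tendsto_finsetSum _ fun k _ =>
        ((ENNReal.continuous_rpow_const.tendsto _).comp
          (ENNReal.tendsto_nat_tsum fun j => x j k))
    exact le_of_tendsto' hlim fun n => (ENNReal.sum_le_tsum t).trans (key n)

/-! ### Integrals of atoms. -/

variable {I : Type*} [MeasurableSpace I]

theorem eLpNorm_ofReal_eq_lintegral {p : ℝ} (hp : 0 < p) (m : Measure I) (f : I → ℂ) :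
    eLpNorm f (ENNReal.ofReal p) m = (∫⁻ x, ‖f x‖ₑ ^ p ∂m) ^ (1 / p) := by
  rw [eLpNorm_eq_lintegral_rpow_enorm_toReal (by simpa using hp) ENNReal.ofReal_ne_top,
    ENNReal.toReal_ofReal hp.le]

theorem osc_eq_iInf_eLpNorm {p : ℝ} (hp : 0 < p) (m : Measure I) (f : I → ℂ) (Q : Set I) :
    osc m p f Q = ⨅ c : ℂ, eLpNorm (fun x => f x - c) (ENNReal.ofReal p) (m.restrict Q) := by
  simp_rw [osc, eLpNorm_ofReal_eq_lintegral hp]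

theorem enorm_le_of_mem_souzaAtoms {m : Measure I} [IsFiniteMeasure m] {s p : ℝ} {Q : Set I}
    (hQ : m Q ≠ 0) {a : I → ℂ} (ha : a ∈ souzaAtoms m s p Q) (x : I) :
    ‖a x‖ₑ ≤ m Q ^ (s - 1 / p) := by
  have h : 0 < m.real Q := ENNReal.toReal_pos hQ (measure_ne_top m Q)
  rw [← ofReal_norm, ← ofReal_measureReal (measure_ne_top m Q), ENNReal.ofReal_rpow_of_pos h]
  exact ENNReal.ofReal_le_ofReal (ha.2.2 x)

theorem measurable_of_mem_souzaAtoms {m : Measure I} {s p : ℝ} {Q : Set I}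
    (hQ : MeasurableSet Q) {a : I → ℂ} (ha : a ∈ souzaAtoms m s p Q) : Measurable a := by
  rcases Q.eq_empty_or_nonempty with rfl | ⟨y, hy⟩
  · rw [show a = fun _ => 0 from funext fun x => ha.1 x (by simp)]
    exact measurable_const
  · rw [show a = Q.indicator fun _ => a y from ?_]
    · exact measurable_const.indicator hQ
    · ext x
      by_cases hx : x ∈ Q
      · rw [Set.indicator_of_mem hx, ha.2.1 x hx y hy]
      · rw [Set.indicator_of_notMem hx, ha.1 x hx]

/-- Disjoint supports turn the `p`-th power of the sum into a sum of `p`-th powers, and `|a_R|^p ≤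
|R|^(sp - 1)`. The atoms are normalised by `m` but integrated against `ν`, which will be either `m`
or a `levelMeasure`; `hB` is what makes each cell cost at most `B^p |c_R|^p`. -/
theorem eLpNorm_sum_mul_le {m ν : Measure I} [IsFiniteMeasure m] {s p : ℝ} (hp : 1 ≤ p)
    {F : Finset (Set I)} (hF : ∀ R ∈ F, MeasurableSet R) (h0 : ∀ R ∈ F, m R ≠ 0)
    (hd : ∀ Q ∈ F, ∀ R ∈ F, Q ≠ R → Disjoint Q R)
    {c : Set I → ℂ} {a : Set I → I → ℂ} (ha : ∀ R ∈ F, a R ∈ souzaAtoms m s p R)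
    {B : ℝ≥0∞} (hB : ∀ R ∈ F, ν R ≤ B ^ p * m R ^ (1 - s * p)) :
    eLpNorm (fun x => ∑ Q ∈ F, c Q * a Q x) (ENNReal.ofReal p) ν ≤
      B * (∑ Q ∈ F, ‖c Q‖ₑ ^ p) ^ (1 / p) := by
  have hp0 : 0 < p := by positivity
  have hpt : ∀ x, ‖∑ Q ∈ F, c Q * a Q x‖ₑ ^ p ≤
      ∑ Q ∈ F, Q.indicator (fun _ => ‖c Q‖ₑ ^ p * m Q ^ ((s - 1 / p) * p)) x := by
    intro x
    by_cases hx : ∃ R ∈ F, x ∈ R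
    · obtain ⟨R, hR, hxR⟩ := hx
      rw [Finset.sum_eq_single_of_mem R hR fun Q hQ hne => by
        rw [(ha Q hQ).1 x (Set.disjoint_left.1 (hd R hR Q hQ hne.symm) hxR), mul_zero]]
      refine le_trans ?_ (Finset.single_le_sum
        (f := fun Q : Set I => Q.indicator (fun _ => ‖c Q‖ₑ ^ p * m Q ^ ((s - 1 / p) * p)) x)
        (fun _ _ => zero_le) hR)
      rw [Set.indicator_of_mem hxR, enorm_mul, ENNReal.mul_rpow_of_nonneg _ _ hp0.le,
        ENNReal.rpow_mul]
      gcongr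
      exact enorm_le_of_mem_souzaAtoms (h0 R hR) (ha R hR) x
    · rw [Finset.sum_eq_zero fun Q hQ => by
        rw [(ha Q hQ).1 x fun h => hx ⟨Q, hQ, h⟩, mul_zero]]
      simp [hp0]
  rw [eLpNorm_ofReal_eq_lintegral hp0]
  have hint : ∫⁻ x, ‖∑ Q ∈ F, c Q * a Q x‖ₑ ^ p ∂ν ≤ B ^ p * ∑ Q ∈ F, ‖c Q‖ₑ ^ p := by
    refine (lintegral_mono hpt).trans ?_
    rw [lintegral_finsetSum _ fun Q hQ => measurable_const.indicator (hF Q hQ), Finset.mul_sum]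
    refine Finset.sum_le_sum fun R hR => ?_
    rw [lintegral_indicator_const (hF R hR)]
    calc ‖c R‖ₑ ^ p * m R ^ ((s - 1 / p) * p) * ν R
        ≤ ‖c R‖ₑ ^ p * m R ^ ((s - 1 / p) * p) * (B ^ p * m R ^ (1 - s * p)) := by
          gcongr; exact hB R hR
      _ = B ^ p * ‖c R‖ₑ ^ p * (m R ^ ((s - 1 / p) * p) * m R ^ (1 - s * p)) := by ring
      _ = B ^ p * ‖c R‖ₑ ^ p := by
          rw [← ENNReal.rpow_add _ _ (h0 R hR) (measure_ne_top m R),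
            show (s - 1 / p) * p + (1 - s * p) = 0 by field_simp; ring, ENNReal.rpow_zero, mul_one]
  calc _ ≤ (B ^ p * ∑ Q ∈ F, ‖c Q‖ₑ ^ p) ^ (1 / p) := by gcongr
    _ = _ := by
      rw [ENNReal.mul_rpow_of_nonneg _ _ (by positivity), ← ENNReal.rpow_mul,
        mul_one_div_cancel hp0.ne', ENNReal.rpow_one]

/-! ### Geometry of the grid and weighted measures. -/

section Grid

variable {m : Measure I} {P : ℕ → Finset (Set I)} {l₁ l₂ : ℝ}

theorem IsGoodGrid.eq_of_mem (hP : IsGoodGrid m P l₁ l₂) {k : ℕ} {Q R : Set I}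
    (hQ : Q ∈ P k) (hR : R ∈ P k) {x : I} (hxQ : x ∈ Q) (hxR : x ∈ R) : Q = R := by
  by_contra h
  exact Set.disjoint_left.1 (hP.disjoint k Q hQ R hR h) hxQ hxR

theorem IsGoodGrid.nonempty (hP : IsGoodGrid m P l₁ l₂) {k : ℕ} {Q : Set I}
    (hQ : Q ∈ P k) : Q.Nonempty :=
  nonempty_of_measure_ne_zero (hP.measure_pos k Q hQ).ne'

theorem IsGoodGrid.measure_le [IsFiniteMeasure m] (hP : IsGoodGrid m P l₁ l₂) {k : ℕ}
    {Q R : Set I} (hR : R ∈ P k) (hQ : Q ∈ P (k + 1)) (h : Q ⊆ R) :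
    m Q ≤ ENNReal.ofReal l₂ * m R := by
  have hR0 : 0 < m.real R := ENNReal.toReal_pos (hP.measure_pos k R hR).ne' (measure_ne_top m R)
  have := (div_le_iff₀ hR0).1 (hP.ratio k R hR Q hQ h).2
  rw [← ofReal_measureReal (measure_ne_top m Q), ← ofReal_measureReal (measure_ne_top m R),
    ← ENNReal.ofReal_mul (hP.pos.trans hP.lt).le]
  exact ENNReal.ofReal_le_ofReal this

theorem IsGoodGrid.le_measure [IsFiniteMeasure m] (hP : IsGoodGrid m P l₁ l₂) {k : ℕ}
    {Q R : Set I} (hR : R ∈ P k) (hQ : Q ∈ P (k + 1)) (h : Q ⊆ R) :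
    ENNReal.ofReal l₁ * m R ≤ m Q := by
  have hR0 : 0 < m.real R := ENNReal.toReal_pos (hP.measure_pos k R hR).ne' (measure_ne_top m R)
  have := (le_div_iff₀ hR0).1 (hP.ratio k R hR Q hQ h).1
  rw [← ofReal_measureReal (measure_ne_top m Q), ← ofReal_measureReal (measure_ne_top m R),
    ← ENNReal.ofReal_mul hP.pos.le]
  exact ENNReal.ofReal_le_ofReal this

theorem IsGoodGrid.exists_ancestor [IsFiniteMeasure m] (hP : IsGoodGrid m P l₁ l₂) (k j : ℕ) :
    ∀ R ∈ P (k + j), ∃ Q ∈ P k, R ⊆ Q ∧ m R ≤ ENNReal.ofReal l₂ ^ j * m Q := by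
  induction j with
  | zero => exact fun R hR => ⟨R, hR, subset_rfl, by simp⟩
  | succ j ih =>
    intro R hR
    obtain ⟨S, hS, hRS⟩ := hP.nested (k + j) R hR
    obtain ⟨Q, hQ, hSQ, hm⟩ := ih S hS
    refine ⟨Q, hQ, hRS.trans hSQ, (hP.measure_le hS hR hRS).trans ?_⟩
    rw [pow_succ', mul_assoc]
    gcongr

theorem IsGoodGrid.subset_of_mem [IsFiniteMeasure m] (hP : IsGoodGrid m P l₁ l₂) {k n : ℕ}
    (hkn : k ≤ n) {Q R : Set I} (hR : R ∈ P k) (hQ : Q ∈ P n) {x : I} (hxQ : x ∈ Q)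
    (hxR : x ∈ R) : Q ⊆ R := by
  obtain ⟨j, rfl⟩ := Nat.exists_eq_add_of_le hkn
  obtain ⟨S, hS, hQS, -⟩ := hP.exists_ancestor k j Q hQ
  rwa [hP.eq_of_mem hR hS hxR (hQS hxQ)]

theorem IsGoodGrid.measure_le_pow [IsFiniteMeasure m] (hP : IsGoodGrid m P l₁ l₂) {k : ℕ}
    {Q : Set I} (hQ : Q ∈ P k) : m Q ≤ ENNReal.ofReal l₂ ^ k * m Set.univ := by
  obtain ⟨R, hR, -, h⟩ := hP.exists_ancestor 0 k Q (by rwa [zero_add])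
  rw [hP.level_zero, Finset.mem_singleton] at hR
  rwa [hR] at h

/-- The measure on `I` obtained from `m` by giving the cells `Q` of level `k` the weight
`|Q| ^ (-s p)`. -/
noncomputable def levelMeasure (m : Measure I) (P : ℕ → Finset (Set I)) (s p : ℝ) (k : ℕ) :
    Measure I :=
  ∑ Q ∈ P k, m Q ^ (-(s * p)) • m.restrict Q

theorem IsGoodGrid.levelMeasure_apply (hP : IsGoodGrid m P l₁ l₂) (s p : ℝ) {k : ℕ}
    {Q R : Set I} (hQ : Q ∈ P k) (hR : MeasurableSet R) (h : R ⊆ Q) :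
    levelMeasure m P s p k R = m Q ^ (-(s * p)) * m R := by
  simp only [levelMeasure, Measure.coe_finsetSum, Finset.sum_apply, Measure.smul_apply,
    smul_eq_mul, Measure.restrict_apply hR]
  rw [Finset.sum_eq_single_of_mem Q hQ, Set.inter_eq_left.2 h]
  intro S hS hne
  rw [Disjoint.inter_eq ((hP.disjoint k S hS Q hQ hne).symm.mono_left h), measure_empty, mul_zero]

/-- Only the finiteness of the factor matters: it transfers convergence in `L^p(m)` to the weighted
measure and does not enter the final bounds. -/
theorem levelMeasure_le (s p : ℝ) (k : ℕ) :
    levelMeasure m P s p k ≤ (∑ Q ∈ P k, m Q ^ (-(s * p))) • m := by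
  rw [levelMeasure, Finset.sum_smul]
  refine Finset.sum_le_sum fun Q _ => ?_
  gcongr
  exact Measure.restrict_le_self

theorem IsGoodGrid.sum_measure_rpow_ne_top [IsFiniteMeasure m] (hP : IsGoodGrid m P l₁ l₂)
    (r : ℝ) (k : ℕ) : ∑ Q ∈ P k, m Q ^ r ≠ ∞ :=
  ENNReal.sum_ne_top.2 fun Q hQ =>
    ENNReal.rpow_ne_top_of_ne_zero (hP.measure_pos k Q hQ).ne' (measure_ne_top m Q)

/-- The value of `S` on each cell is a competitor for the oscillation. The level sum thus becomes
one `L^p` norm, to which Minkowski applies. -/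
theorem sum_osc_rpow_le {s p : ℝ} (hp : 0 < p) (f S : I → ℂ) (k : ℕ)
    (hm : ∀ Q ∈ P k, MeasurableSet Q)
    (hS : ∀ Q ∈ P k, ∃ b, ∀ x ∈ Q, S x = b) :
    (∑ Q ∈ P k, m Q ^ (-(s * p)) * osc m p f Q ^ p) ^ (1 / p) ≤
      eLpNorm (fun x => f x - S x) (ENNReal.ofReal p) (levelMeasure m P s p k) := by
  rw [eLpNorm_ofReal_eq_lintegral hp, levelMeasure, lintegral_finsetSum_measure]
  gcongr with Q hQ
  rw [lintegral_smul_measure, smul_eq_mul]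
  gcongr
  obtain ⟨b, hb⟩ := hS Q hQ
  rw [← ENNReal.le_rpow_inv_iff hp, ← one_div]
  refine (iInf_le _ b).trans_eq ?_
  congr 1
  exact setLIntegral_congr_fun (hm Q hQ) fun x hx => by simp [hb x hx]

end Grid

/-- `C` is absent from the bound because it multiplies only the remainder after `n + N` terms, which
vanishes as `N → ∞`. -/
theorem eLpNorm_sub_sum_le_tsum {p : ℝ≥0∞} (hp : 1 ≤ p) (hp' : p ≠ ∞) {m ν : Measure I}
    {C : ℝ≥0∞} (hC : C ≠ ∞) (hν : ν ≤ C • m) {f : I → ℂ} {u : ℕ → I → ℂ}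
    (hf : AEStronglyMeasurable f m) (hu : ∀ k, AEStronglyMeasurable (u k) m)
    (h : Tendsto (fun n => eLpNorm (fun x => f x - ∑ k ∈ Finset.range n, u k x) p m) atTop (𝓝 0))
    (n : ℕ) :
    eLpNorm (fun x => f x - ∑ k ∈ Finset.range n, u k x) p ν ≤
      ∑' j, eLpNorm (u (n + j)) p ν := by
  have hac : ν ≪ m := (Measure.absolutelyContinuous_of_le hν).trans
    Measure.smul_absolutelyContinuous
  have hf' := hf.mono_ac hac
  have hu' := fun k => (hu k).mono_ac hac
  have hS : ∀ (N : ℕ) (v : ℕ → ℕ), AEStronglyMeasurable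
      (fun x => ∑ k ∈ Finset.range N, u (v k) x) ν := fun N v => by
    have := Finset.aestronglyMeasurable_sum (Finset.range N) fun k _ => hu' (v k)
    simpa [Finset.sum_fn] using this
  have key : ∀ N, eLpNorm (fun x => f x - ∑ k ∈ Finset.range n, u k x) p ν ≤
      C ^ (1 / p).toReal * eLpNorm (fun x => f x - ∑ k ∈ Finset.range (n + N), u k x) p m +
        ∑' j, eLpNorm (u (n + j)) p ν := by
    intro N
    have e : (fun x => f x - ∑ k ∈ Finset.range n, u k x) =
        (fun x => f x - ∑ k ∈ Finset.range (n + N), u k x) +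
          ∑ j ∈ Finset.range N, u (n + j) := by
      ext x
      simp only [Pi.add_apply, Finset.sum_apply, Finset.sum_range_add]
      ring
    rw [e]
    refine (eLpNorm_add_le (hf'.sub (hS _ id)) ?_ hp).trans (add_le_add ?_ ?_)
    · exact Finset.aestronglyMeasurable_sum _ fun k _ => hu' (n + k)
    · refine (eLpNorm_mono_measure _ hν).trans_eq ?_
      rw [eLpNorm_smul_measure_of_ne_top hp', smul_eq_mul]
      rfl
    · exact (eLpNorm_sum_le (fun k _ => hu' (n + k)) hp).trans (ENNReal.sum_le_tsum _)
  have hC' : C ^ (1 / p).toReal ≠ ∞ := ENNReal.rpow_ne_top_of_nonneg ENNReal.toReal_nonneg hC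
  have hlim := (ENNReal.Tendsto.const_mul (a := C ^ (1 / p).toReal)
    (h.comp (tendsto_add_atTop_nat n)) (Or.inr hC')).add_const (∑' j, eLpNorm (u (n + j)) p ν)
  rw [mul_zero, zero_add] at hlim
  refine ge_of_tendsto' hlim fun N => ?_
  simpa only [Function.comp_apply, add_comm N n] using key N

/-! ### The cost of a representation controls the `L^p` norm and the oscillation. -/

section Direct

variable {m : Measure I} {P : ℕ → Finset (Set I)} {l₁ l₂ s p : ℝ}
  {q : ℝ≥0∞} {c : Set I → ℂ} {a : Set I → I → ℂ} {f : I → ℂ}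

theorem pow_rpow_comm (x : ℝ≥0∞) (k : ℕ) (s : ℝ) : (x ^ k) ^ s = (x ^ s) ^ k := by
  rw [← ENNReal.rpow_natCast, ← ENNReal.rpow_mul, mul_comm, ENNReal.rpow_mul,
    ENNReal.rpow_natCast]

theorem IsGoodGrid.measurable_level (hP : IsGoodGrid m P l₁ l₂) {k : ℕ}
    (ha : ∀ Q ∈ P k, a Q ∈ souzaAtoms m s p Q) :
    Measurable fun x => ∑ Q ∈ P k, c Q * a Q x :=
  Finset.measurable_fun_sum _ fun Q hQ =>
    measurable_const.mul (measurable_of_mem_souzaAtoms (hP.measurableSet k Q hQ) (ha Q hQ))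

theorem IsGoodGrid.rpow_lt_one (hP : IsGoodGrid m P l₁ l₂) (hs : 0 < s) :
    ENNReal.ofReal l₂ ^ s < 1 :=
  ENNReal.rpow_lt_one (ENNReal.ofReal_lt_one.2 hP.lt_one) hs

variable [IsFiniteMeasure m]

theorem IsGoodGrid.eLpNorm_level_le (hP : IsGoodGrid m P l₁ l₂) (hp : 1 ≤ p) (hs : 0 < s) {k : ℕ}
    (ha : ∀ Q ∈ P k, a Q ∈ souzaAtoms m s p Q) :
    eLpNorm (fun x => ∑ Q ∈ P k, c Q * a Q x) (ENNReal.ofReal p) m ≤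
      m Set.univ ^ s * ((ENNReal.ofReal l₂ ^ s) ^ k * (∑ Q ∈ P k, ‖c Q‖ₑ ^ p) ^ (1 / p)) := by
  rw [← pow_rpow_comm, ← mul_assoc, ← ENNReal.mul_rpow_of_nonneg _ _ hs.le,
    mul_comm (m Set.univ)]
  have h0 : ∀ R ∈ P k, m R ≠ 0 := fun R hR => (hP.measure_pos k R hR).ne'
  refine eLpNorm_sum_mul_le hp (hP.measurableSet k) h0 (hP.disjoint k) ha fun R hR => ?_
  rw [← ENNReal.rpow_mul]
  calc m R = m R ^ (s * p) * m R ^ (1 - s * p) := by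
        rw [← ENNReal.rpow_add _ _ (h0 R hR) (measure_ne_top m R), add_sub_cancel,
          ENNReal.rpow_one]
    _ ≤ _ := by gcongr; exact hP.measure_le_pow hR

/-- Inside `Q` of level `n`, a cell `R` that is `j` levels finer has `|R|^(sp) ≤ (l₂^j |Q|)^(sp)`.
The weight `|Q|^(-sp)` cancels `|Q|^(sp)` exactly, leaving decay in `j` uniform in `n`. -/
theorem IsGoodGrid.eLpNorm_levelMeasure_le (hP : IsGoodGrid m P l₁ l₂) (hp : 1 ≤ p) (hs : 0 < s)
    {n j : ℕ} (ha : ∀ Q ∈ P (n + j), a Q ∈ souzaAtoms m s p Q) :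
    eLpNorm (fun x => ∑ Q ∈ P (n + j), c Q * a Q x) (ENNReal.ofReal p)
        (levelMeasure m P s p n) ≤
      (ENNReal.ofReal l₂ ^ s) ^ j * (∑ Q ∈ P (n + j), ‖c Q‖ₑ ^ p) ^ (1 / p) := by
  rw [← pow_rpow_comm]
  have h0 : ∀ R ∈ P (n + j), m R ≠ 0 := fun R hR => (hP.measure_pos _ R hR).ne'
  refine eLpNorm_sum_mul_le hp (hP.measurableSet _) h0 (hP.disjoint _) ha fun R hR => ?_
  obtain ⟨Q, hQ, hRQ, hm⟩ := hP.exists_ancestor n j R hR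
  have hQ0 : m Q ≠ 0 := (hP.measure_pos n Q hQ).ne'
  have hsp : 0 ≤ s * p := by positivity
  rw [← ENNReal.rpow_mul, hP.levelMeasure_apply s p hQ (hP.measurableSet _ R hR) hRQ]
  calc m Q ^ (-(s * p)) * m R = m Q ^ (-(s * p)) * (m R ^ (s * p) * m R ^ (1 - s * p)) := by
        rw [← ENNReal.rpow_add _ _ (h0 R hR) (measure_ne_top m R), add_sub_cancel,
          ENNReal.rpow_one]
    _ ≤ m Q ^ (-(s * p)) *
          ((ENNReal.ofReal l₂ ^ j * m Q) ^ (s * p) * m R ^ (1 - s * p)) := by gcongr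
    _ = m Q ^ (-(s * p)) * m Q ^ (s * p) *
          ((ENNReal.ofReal l₂ ^ j) ^ (s * p) * m R ^ (1 - s * p)) := by
        rw [ENNReal.mul_rpow_of_nonneg _ _ hsp]; ring
    _ = _ := by
        rw [← ENNReal.rpow_add _ _ hQ0 (measure_ne_top m Q), neg_add_cancel, ENNReal.rpow_zero,
          one_mul]

theorem IsGoodGrid.tsum_eLpNorm_level_le (hP : IsGoodGrid m P l₁ l₂) (hp : 1 ≤ p) (hq : 1 ≤ q)
    (hs : 0 < s) (ha : ∀ k, ∀ Q ∈ P k, a Q ∈ souzaAtoms m s p Q) :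
    ∑' k, eLpNorm (fun x => ∑ Q ∈ P k, c Q * a Q x) (ENNReal.ofReal p) m ≤
      m Set.univ ^ s * (1 - ENNReal.ofReal l₂ ^ s)⁻¹ * cost P p q c := by
  rw [← ENNReal.tsum_geometric, mul_assoc, ← ENNReal.tsum_mul_right, ← ENNReal.tsum_mul_left]
  refine ENNReal.tsum_le_tsum fun k => (hP.eLpNorm_level_le hp hs (ha k)).trans ?_
  gcongr
  exact le_lqNorm hq (fun k => (∑ Q ∈ P k, ‖c Q‖ₑ ^ p) ^ (1 / p)) k

theorem IsRepresentation.eLpNorm_le (hP : IsGoodGrid m P l₁ l₂) (hp : 1 ≤ p) (hq : 1 ≤ q)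
    (hs : 0 < s) (hf : AEStronglyMeasurable f m) (h : IsRepresentation m P s p q f c a) :
    eLpNorm f (ENNReal.ofReal p) m ≤
      m Set.univ ^ s * (1 - ENNReal.ofReal l₂ ^ s)⁻¹ * cost P p q c := by
  have h1 := eLpNorm_sub_sum_le_tsum (C := 1) (ν := m) (ENNReal.one_le_ofReal.2 hp)
    ENNReal.ofReal_ne_top ENNReal.one_ne_top (by simp) hf
    (fun k => (hP.measurable_level (c := c) (h.atom k)).aestronglyMeasurable) h.tendsto 0
  simp only [Finset.range_zero, Finset.sum_empty, sub_zero, zero_add] at h1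
  exact h1.trans (hP.tsum_eLpNorm_level_le hp hq hs h.atom)

theorem IsRepresentation.oscNorm_le (hP : IsGoodGrid m P l₁ l₂) (hp : 1 ≤ p) (hq : 1 ≤ q)
    (hs : 0 < s) (hf : AEStronglyMeasurable f m) (h : IsRepresentation m P s p q f c a) :
    oscNorm m P s p q f ≤ (1 - ENNReal.ofReal l₂ ^ s)⁻¹ * cost P p q c := by
  have hp0 : 0 < p := by positivity
  set y : ℕ → ℝ≥0∞ := fun k => (∑ Q ∈ P k, ‖c Q‖ₑ ^ p) ^ (1 / p)
  have hx : ∀ k, (∑ Q ∈ P k, m Q ^ (-(s * p)) * osc m p f Q ^ p) ^ (1 / p) ≤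
      ∑' j, (ENNReal.ofReal l₂ ^ s) ^ j * y (k + (1 + j)) := by
    intro k
    -- The range `k + 1` includes level `k`, whose atoms are still constant on the cells of that
    -- level.
    refine (sum_osc_rpow_le hp0 f
      (fun x => ∑ i ∈ Finset.range (k + 1), ∑ Q ∈ P i, c Q * a Q x) k
      (hP.measurableSet k) ?_).trans ?_
    · intro Q hQ
      obtain ⟨x₀, hx₀⟩ := hP.nonempty hQ
      refine ⟨∑ i ∈ Finset.range (k + 1), ∑ R ∈ P i, c R * a R x₀, fun x hx =>
        Finset.sum_congr rfl fun i hi => Finset.sum_congr rfl fun R hR => ?_⟩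
      congr 1
      have hik : i ≤ k := Nat.lt_succ_iff.1 (Finset.mem_range.1 hi)
      by_cases hxR : x ∈ R
      · exact (h.atom i R hR).2.1 x hxR x₀ (hP.subset_of_mem hik hR hQ hx hxR hx₀)
      · rw [(h.atom i R hR).1 x hxR, (h.atom i R hR).1 x₀
          fun h' => hxR (hP.subset_of_mem hik hR hQ hx₀ h' hx)]
    · refine (eLpNorm_sub_sum_le_tsum (ENNReal.one_le_ofReal.2 hp)
        ENNReal.ofReal_ne_top (hP.sum_measure_rpow_ne_top (-(s * p)) k) (levelMeasure_le s p k) hf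
        (fun k => (hP.measurable_level (c := c) (h.atom k)).aestronglyMeasurable) h.tendsto
        (k + 1)).trans ?_
      refine ENNReal.tsum_le_tsum fun j => ?_
      rw [add_assoc]
      refine (hP.eLpNorm_levelMeasure_le hp hs (h.atom (k + (1 + j)))).trans ?_
      gcongr ?_ * _
      -- The exponent is `1 + j`; one factor below `1` is dropped to get a plain geometric series.
      exact pow_le_pow_right_of_le_one' (hP.rpow_lt_one hs).le (by lia)
  refine (lqNorm_mono hx).trans ((lqNorm_tsum_le hq
    (fun j k => (ENNReal.ofReal l₂ ^ s) ^ j * y (k + (1 + j)))).trans ?_)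
  rw [← ENNReal.tsum_geometric, ← ENNReal.tsum_mul_right]
  refine ENNReal.tsum_le_tsum fun j => ?_
  rw [lqNorm_const_mul hq]
  gcongr
  exact lqNorm_comp_add_right_le y (1 + j)

end Direct

/-! ### Finite oscillation yields a representation by differences of averages. -/

section Converse

variable {m : Measure I} {P : ℕ → Finset (Set I)} {l₁ l₂ s p : ℝ} {q : ℝ≥0∞} {f : I → ℂ}

/-- A parent map depending on the set alone is possible because a set lies in at most one level. -/
theorem IsGoodGrid.exists_parent (hP : IsGoodGrid m P l₁ l₂) :
    ∃ par : Set I → Set I, ∀ k, ∀ Q ∈ P (k + 1), par Q ∈ P k ∧ Q ⊆ par Q := by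
  have h : ∀ Q : Set I, ∃ R : Set I, ∀ k, Q ∈ P (k + 1) → R ∈ P k ∧ Q ⊆ R := by
    intro Q
    by_cases hQ : ∃ k, Q ∈ P (k + 1)
    · obtain ⟨k, hk⟩ := hQ
      obtain ⟨R, hR, hQR⟩ := hP.nested k Q hk
      refine ⟨R, fun j hj => ?_⟩
      obtain rfl : j = k := by
        by_contra hne
        exact hP.levels_ne (j + 1) (k + 1) (by lia) Q hj Q hk rfl
      exact ⟨hR, hQR⟩
    · exact ⟨∅, fun k hk => absurd ⟨k, hk⟩ hQ⟩
  choose par hpar using h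
  exact ⟨par, fun k Q hQ => hpar Q k hQ⟩

theorem IsGoodGrid.lintegral_eq_sum (hP : IsGoodGrid m P l₁ l₂) (k : ℕ) (h : I → ℝ≥0∞) :
    ∫⁻ x, h x ∂m = ∑ Q ∈ P k, ∫⁻ x in Q, h x ∂m := by
  rw [← lintegral_biUnion_finset (fun Q hQ R hR hne => hP.disjoint k Q hQ R hR hne)
    (hP.measurableSet k), Measure.restrict_eq_self_of_ae_mem]
  exact mem_ae_iff.2 (hP.cover k)

variable [IsFiniteMeasure m]

/-- Hölder on `Q`, applied to `f - b`. -/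
theorem enorm_setAverage_sub_mul_le (hp : 1 ≤ p) (hf : MemLp f (ENNReal.ofReal p) m) {Q : Set I}
    (hQ : m Q ≠ 0) (b : ℂ) :
    ‖(⨍ x in Q, f x ∂m) - b‖ₑ * m Q ^ (1 / p) ≤
      eLpNorm (fun x => f x - b) (ENNReal.ofReal p) (m.restrict Q) := by
  have hp0 : 0 < p := by positivity
  have hQt : m Q ≠ ∞ := measure_ne_top m Q
  have hr : m.real Q ≠ 0 := (ENNReal.toReal_pos hQ hQt).ne'
  have hint : Integrable f (m.restrict Q) :=
    (hf.integrable (ENNReal.one_le_ofReal.2 hp)).restrict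
  have e : (⨍ x in Q, f x ∂m) - b = (m.real Q)⁻¹ • ∫ x in Q, (f x - b) ∂m := by
    rw [integral_sub hint (integrable_const b), setIntegral_const, smul_sub, setAverage_eq,
      inv_smul_smul₀ hr]
  have h1 : ‖∫ x in Q, (f x - b) ∂m‖ₑ ≤
      eLpNorm (fun x => f x - b) (ENNReal.ofReal p) (m.restrict Q) * m Q ^ (1 - 1 / p) := by
    refine (enorm_integral_le_lintegral_enorm _).trans ?_
    rw [← eLpNorm_one_eq_lintegral_enorm]
    refine (eLpNorm_le_eLpNorm_mul_rpow_measure_univ (ENNReal.one_le_ofReal.2 hp)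
      (hint.aestronglyMeasurable.sub aestronglyMeasurable_const)).trans_eq ?_
    rw [ENNReal.toReal_ofReal hp0.le, Measure.restrict_apply_univ, ENNReal.toReal_one, one_div_one]
    rfl
  have h2 : ‖(m.real Q)⁻¹‖ₑ = m Q ^ (-1 : ℝ) := by
    rw [enorm_inv hr, ENNReal.rpow_neg_one, Real.enorm_of_nonneg measureReal_nonneg,
      ofReal_measureReal hQt]
  rw [e, enorm_smul, h2]
  calc _ ≤ m Q ^ (-1 : ℝ) * (eLpNorm (fun x => f x - b) (ENNReal.ofReal p) (m.restrict Q) *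
          m Q ^ (1 - 1 / p)) * m Q ^ (1 / p) := by gcongr
    _ = eLpNorm (fun x => f x - b) (ENNReal.ofReal p) (m.restrict Q) *
          (m Q ^ (-1 : ℝ) * m Q ^ (1 - 1 / p) * m Q ^ (1 / p)) := by ring
    _ = _ := by
      rw [← ENNReal.rpow_add _ _ hQ hQt, ← ENNReal.rpow_add _ _ hQ hQt,
        show (-1 : ℝ) + (1 - 1 / p) + 1 / p = 0 by ring, ENNReal.rpow_zero, mul_one]

/-- The average is optimal up to a factor `2`: its distance to any competitor `b` is at most that of
`f` to `b`. -/
theorem eLpNorm_sub_setAverage_le (hp : 1 ≤ p) (hf : MemLp f (ENNReal.ofReal p) m) {Q : Set I}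
    (hQ : m Q ≠ 0) :
    eLpNorm (fun x => f x - ⨍ y in Q, f y ∂m) (ENNReal.ofReal p) (m.restrict Q) ≤
      2 * osc m p f Q := by
  have hp0 : 0 < p := by positivity
  have hp1 := ENNReal.one_le_ofReal.2 hp
  rw [osc_eq_iInf_eLpNorm hp0, ENNReal.mul_iInf_of_ne two_ne_zero ENNReal.ofNat_ne_top]
  refine le_iInf fun b => ?_
  have hfm := hf.aestronglyMeasurable.restrict (s := Q)
  have e : (fun x => f x - ⨍ y in Q, f y ∂m) =
      (fun x => f x - b) - fun _ => (⨍ y in Q, f y ∂m) - b := by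
    ext x; simp
  rw [e, two_mul]
  refine (eLpNorm_sub_le (hfm.sub aestronglyMeasurable_const) aestronglyMeasurable_const hp1).trans
    (add_le_add le_rfl ?_)
  rw [eLpNorm_const' _ (by simpa using hp0) ENNReal.ofReal_ne_top, ENNReal.toReal_ofReal hp0.le,
    Measure.restrict_apply_univ]
  exact enorm_setAverage_sub_mul_le hp hf hQ b

theorem lintegral_sub_setAverage_le (hp : 1 ≤ p) (hf : MemLp f (ENNReal.ofReal p) m) {Q : Set I}
    (hQ : m Q ≠ 0) :
    ∫⁻ x in Q, ‖f x - ⨍ y in Q, f y ∂m‖ₑ ^ p ∂m ≤ 2 ^ p * osc m p f Q ^ p := by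
  have hp0 : 0 < p := by positivity
  have h := eLpNorm_sub_setAverage_le hp hf hQ
  rw [eLpNorm_ofReal_eq_lintegral hp0, one_div, ENNReal.rpow_inv_le_iff hp0,
    ENNReal.mul_rpow_of_nonneg _ _ hp0.le] at h
  exact h

/-- Writing `1 = |Q|^(sp) |Q|^(-sp)` with `|Q| ≤ l₂^n |I|` gives convergence of the averages in
`L^p` at a geometric rate, directly from finite oscillation. -/
theorem IsGoodGrid.eLpNorm_sub_le_level (hP : IsGoodGrid m P l₁ l₂) (hp : 1 ≤ p) (hs : 0 < s)
    (hf : MemLp f (ENNReal.ofReal p) m) {n : ℕ} {S : I → ℂ}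
    (hS : ∀ Q ∈ P n, ∀ x ∈ Q, S x = ⨍ y in Q, f y ∂m) :
    eLpNorm (fun x => f x - S x) (ENNReal.ofReal p) m ≤
      2 * m Set.univ ^ s * (ENNReal.ofReal l₂ ^ s) ^ n *
        (∑ Q ∈ P n, m Q ^ (-(s * p)) * osc m p f Q ^ p) ^ (1 / p) := by
  have hp0 : 0 < p := by positivity
  have hsp : 0 ≤ s * p := by positivity
  rw [eLpNorm_ofReal_eq_lintegral hp0, one_div, ENNReal.rpow_inv_le_iff hp0,
    ENNReal.mul_rpow_of_nonneg _ _ hp0.le, ENNReal.rpow_inv_rpow hp0.ne', hP.lintegral_eq_sum n,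
    Finset.mul_sum]
  refine Finset.sum_le_sum fun Q hQ => ?_
  have hQ0 : m Q ≠ 0 := (hP.measure_pos n Q hQ).ne'
  calc ∫⁻ x in Q, ‖f x - S x‖ₑ ^ p ∂m = ∫⁻ x in Q, ‖f x - ⨍ y in Q, f y ∂m‖ₑ ^ p ∂m :=
        setLIntegral_congr_fun (hP.measurableSet n Q hQ) fun x hx => by simp only [hS Q hQ x hx]
    _ ≤ 2 ^ p * osc m p f Q ^ p := lintegral_sub_setAverage_le hp hf hQ0
    _ = 2 ^ p * (m Q ^ (s * p) * m Q ^ (-(s * p))) * osc m p f Q ^ p := by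
        rw [← ENNReal.rpow_add _ _ hQ0 (measure_ne_top m Q), add_neg_cancel, ENNReal.rpow_zero,
          mul_one]
    _ ≤ 2 ^ p * ((ENNReal.ofReal l₂ ^ n * m Set.univ) ^ (s * p) * m Q ^ (-(s * p))) *
          osc m p f Q ^ p := by
        gcongr; exact hP.measure_le_pow hQ
    _ = _ := by
        rw [← pow_rpow_comm, mul_assoc 2, mul_comm (m Set.univ ^ s),
          ← ENNReal.mul_rpow_of_nonneg _ _ hs.le, ENNReal.mul_rpow_of_nonneg _ _ hp0.le,
          ← ENNReal.rpow_mul]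
        ring

/-- Group the cells by parent `R`. The children are disjoint subsets of `R`, so their integrals of
`|f - A_R|^p`, with `A_R` the average over `R`, add up to at most the one over `R`; `|Q| ≥ l₁ |R|`
converts the weights. -/
theorem IsGoodGrid.sum_enorm_sub_parent_le (hP : IsGoodGrid m P l₁ l₂) (hp : 1 ≤ p) (hs : 0 < s)
    (hf : MemLp f (ENNReal.ofReal p) m) {par : Set I → Set I} {k : ℕ}
    (hpar : ∀ Q ∈ P (k + 1), par Q ∈ P k ∧ Q ⊆ par Q) :
    (∑ Q ∈ P (k + 1), (‖(⨍ y in Q, f y ∂m) - ⨍ y in par Q, f y ∂m‖ₑ *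
        m Q ^ (1 / p - s)) ^ p) ^ (1 / p) ≤
      2 * ENNReal.ofReal l₁ ^ (-s) *
        (∑ Q ∈ P k, m Q ^ (-(s * p)) * osc m p f Q ^ p) ^ (1 / p) := by
  classical
  have hp0 : 0 < p := by positivity
  rw [one_div, ENNReal.rpow_inv_le_iff hp0,
    ENNReal.mul_rpow_of_nonneg _ _ hp0.le, ENNReal.rpow_inv_rpow hp0.ne', Finset.mul_sum,
    ← Finset.sum_fiberwise_of_maps_to fun Q hQ => (hpar Q hQ).1]
  refine Finset.sum_le_sum fun R hR => ?_
  set h : I → ℝ≥0∞ := fun x => ‖f x - ⨍ y in R, f y ∂m‖ₑ ^ p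
  have hR0 : m R ≠ 0 := (hP.measure_pos k R hR).ne'
  have hmem : ∀ Q ∈ (P (k + 1)).filter (par · = R), Q ∈ P (k + 1) ∧ Q ⊆ R := fun Q hQ => by
    rw [Finset.mem_filter] at hQ
    exact ⟨hQ.1, hQ.2 ▸ (hpar Q hQ.1).2⟩
  calc ∑ Q ∈ P (k + 1) with par Q = R, (‖(⨍ y in Q, f y ∂m) - ⨍ y in par Q, f y ∂m‖ₑ *
        m Q ^ (p⁻¹ - s)) ^ p
      ≤ ∑ Q ∈ P (k + 1) with par Q = R,
          (ENNReal.ofReal l₁ * m R) ^ (-(s * p)) * ∫⁻ x in Q, h x ∂m := by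
        refine Finset.sum_le_sum fun Q hQ => ?_
        obtain ⟨hQk, hQR⟩ := hmem Q hQ
        have hQ0 : m Q ≠ 0 := (hP.measure_pos _ Q hQk).ne'
        rw [(Finset.mem_filter.1 hQ).2, sub_eq_add_neg p⁻¹,
          ENNReal.rpow_add _ _ hQ0 (measure_ne_top m Q), ← mul_assoc,
          ENNReal.mul_rpow_of_nonneg _ _ hp0.le, ← ENNReal.rpow_mul, mul_comm, neg_mul]
        refine mul_le_mul' ?_ ?_
        · rw [ENNReal.rpow_neg, ENNReal.rpow_neg]
          gcongr
          exact hP.le_measure hR hQk hQR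
        · have := enorm_setAverage_sub_mul_le hp hf hQ0 (⨍ y in R, f y ∂m)
          rw [eLpNorm_ofReal_eq_lintegral hp0, one_div, ENNReal.le_rpow_inv_iff hp0] at this
          exact this
    _ = (ENNReal.ofReal l₁ * m R) ^ (-(s * p)) *
          ∫⁻ x in ⋃ Q ∈ (P (k + 1)).filter (par · = R), Q, h x ∂m := by
        rw [← Finset.mul_sum, lintegral_biUnion_finset
          (fun Q hQ Q' hQ' hne => hP.disjoint (k + 1) Q (hmem Q hQ).1 Q' (hmem Q' hQ').1 hne)
          fun Q hQ => hP.measurableSet (k + 1) Q (hmem Q hQ).1]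
    _ ≤ (ENNReal.ofReal l₁ * m R) ^ (-(s * p)) * (2 ^ p * osc m p f R ^ p) := by
        gcongr
        exact (lintegral_mono_set (Set.iUnion₂_subset fun Q hQ => (hmem Q hQ).2)).trans
          (lintegral_sub_setAverage_le hp hf hR0)
    _ = _ := by
        rw [ENNReal.mul_rpow_of_ne_top ENNReal.ofReal_ne_top (measure_ne_top m R),
          ENNReal.mul_rpow_of_nonneg _ _ hp0.le, ← ENNReal.rpow_mul, neg_mul]
        ring

theorem IsGoodGrid.exists_isRepresentation (hP : IsGoodGrid m P l₁ l₂) (hp : 1 ≤ p)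
    (hq : 1 ≤ q) (hs : 0 < s) (hf : MemLp f (ENNReal.ofReal p) m)
    (hosc : oscNorm m P s p q f < ∞) :
    ∃ c a, IsRepresentation m P s p q f c a ∧
      cost P p q c ≤ m Set.univ ^ (-s) * eLpNorm f (ENNReal.ofReal p) m +
        2 * ENNReal.ofReal l₁ ^ (-s) * oscNorm m P s p q f := by
  classical
  have hp0 : 0 < p := by positivity
  obtain ⟨par, hpar⟩ := hP.exists_parent
  have hU : Set.univ ∈ P 0 := by simp [hP.level_zero]
  have hU0 : m Set.univ ≠ 0 := (hP.measure_pos 0 _ hU).ne'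
  set A : Set I → ℂ := fun Q => ⨍ y in Q, f y ∂m with hA
  set d : Set I → ℂ := fun Q => if Q ∈ P 0 then A Q else A Q - A (par Q)
  -- The two powers of `|Q|` in `c` and `a` are reciprocal, so `c Q * a Q` equals `d Q` on `Q`,
  -- while `a Q` has exactly the maximal height of an atom.
  set c : Set I → ℂ := fun Q => d Q * ((m.real Q ^ (1 / p - s) : ℝ) : ℂ) with hc
  set a : Set I → I → ℂ := fun Q => Q.indicator fun _ => ((m.real Q ^ (s - 1 / p) : ℝ) : ℂ)
    with ha
  have hreal : ∀ k, ∀ Q ∈ P k, 0 < m.real Q := fun k Q hQ =>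
    ENNReal.toReal_pos (hP.measure_pos k Q hQ).ne' (measure_ne_top m Q)
  have hd_succ : ∀ k, ∀ Q ∈ P (k + 1), d Q = A Q - A (par Q) := fun k Q hQ =>
    if_neg fun h0 => hP.levels_ne 0 (k + 1) (by lia) Q h0 Q hQ rfl
  have hca : ∀ k, ∀ Q ∈ P k, ∀ x ∈ Q, c Q * a Q x = d Q := by
    intro k Q hQ x hx
    simp only [hc, ha, Set.indicator_of_mem hx]
    rw [mul_assoc, ← Complex.ofReal_mul, ← Real.rpow_add (hreal k Q hQ)]
    simp
  have hc_enorm : ∀ k, ∀ Q ∈ P k, ‖c Q‖ₑ = ‖d Q‖ₑ * m Q ^ (1 / p - s) := by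
    intro k Q hQ
    simp only [hc]
    rw [enorm_mul, ← ofReal_norm ((_ : ℝ) : ℂ), Complex.norm_real,
      Real.norm_of_nonneg (by positivity), ← ENNReal.ofReal_rpow_of_pos (hreal k Q hQ), ofReal_measureReal (measure_ne_top m Q)]
  -- The differences telescope along the chain of ancestors of `Q`.
  have hsum : ∀ n, ∀ Q ∈ P n, ∀ x ∈ Q,
      ∑ k ∈ Finset.range (n + 1), ∑ R ∈ P k, c R * a R x = A Q := by
    have hlev : ∀ n, ∀ Q ∈ P n, ∀ x ∈ Q, ∑ R ∈ P n, c R * a R x = d Q := by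
      intro n Q hQ x hx
      rw [Finset.sum_eq_single_of_mem Q hQ, hca n Q hQ x hx]
      intro R hR hne
      simp only [ha]
      rw [Set.indicator_of_notMem fun h => hne (hP.eq_of_mem hR hQ h hx), mul_zero]
    intro n
    induction n with
    | zero =>
      intro Q hQ x hx
      rw [zero_add, Finset.sum_range_one, hlev 0 Q hQ x hx]
      exact if_pos hQ
    | succ n ih =>
      intro Q hQ x hx
      rw [Finset.sum_range_succ, ih (par Q) (hpar n Q hQ).1 x ((hpar n Q hQ).2 hx),
        hlev (n + 1) Q hQ x hx, hd_succ n Q hQ, add_sub_cancel]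
  have hatom : ∀ k, ∀ Q ∈ P k, a Q ∈ souzaAtoms m s p Q := by
    intro k Q _
    refine ⟨fun x hx => Set.indicator_of_notMem hx _, fun x hx y hy => ?_, fun x => ?_⟩
    · simp only [ha, Set.indicator_of_mem hx, Set.indicator_of_mem hy]
    · refine (norm_indicator_le_norm_self _ x).trans_eq ?_
      rw [Complex.norm_real, Real.norm_of_nonneg (by positivity)]
  have hcost : cost P p q c ≤ m Set.univ ^ (-s) * eLpNorm f (ENNReal.ofReal p) m +
      2 * ENNReal.ofReal l₁ ^ (-s) * oscNorm m P s p q f := by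
    refine (lqNorm_le_zero_add_succ hq _).trans (add_le_add ?_ ?_)
    · simp only [hP.level_zero, Finset.sum_singleton]
      rw [← ENNReal.rpow_mul, mul_one_div_cancel hp0.ne', ENNReal.rpow_one, hc_enorm 0 _ hU,
        show d Set.univ = A Set.univ from if_pos hU, sub_eq_add_neg,
        ENNReal.rpow_add _ _ hU0 (measure_ne_top m _), ← mul_assoc, mul_comm]
      gcongr
      have h0 := enorm_setAverage_sub_mul_le hp hf hU0 0
      simp only [sub_zero] at h0
      simpa [hA] using h0
    · rw [oscNorm, ← lqNorm_const_mul hq]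
      refine lqNorm_mono fun k => le_trans (le_of_eq ?_)
        (hP.sum_enorm_sub_parent_le hp hs hf (hpar k))
      congr 1
      exact Finset.sum_congr rfl fun Q hQ => by rw [hc_enorm _ Q hQ, hd_succ k Q hQ]
  have hcost_top : cost P p q c < ∞ := by
    refine hcost.trans_lt (ENNReal.add_lt_top.2 ⟨ENNReal.mul_lt_top ?_ hf.2,
      ENNReal.mul_lt_top (ENNReal.mul_lt_top ENNReal.ofNat_lt_top ?_) hosc⟩)
    · exact (ENNReal.rpow_ne_top_of_ne_zero hU0 (measure_ne_top m _)).lt_top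
    · exact (ENNReal.rpow_ne_top_of_ne_zero (by simpa using hP.pos)
        ENNReal.ofReal_ne_top).lt_top
  have hUs : m Set.univ ^ s ≠ ∞ := ENNReal.rpow_ne_top_of_nonneg hs.le (measure_ne_top m _)
  refine ⟨c, a, ⟨hatom, ?_, ?_, hcost_top⟩, hcost⟩
  · refine (hP.tsum_eLpNorm_level_le hp hq hs hatom).trans_lt
      (ENNReal.mul_lt_top (ENNReal.mul_lt_top hUs.lt_top ?_) hcost_top)
    exact ENNReal.inv_lt_top.2 (tsub_pos_of_lt (hP.rpow_lt_one hs))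
  -- `hsum` identifies the sum of the first `n + 1` levels with the averages at level `n`, hence the
  -- shift.
  · rw [← tendsto_add_atTop_iff_nat 1]
    have hlim := ENNReal.Tendsto.mul_const (b := oscNorm m P s p q f)
      (ENNReal.Tendsto.const_mul (a := 2 * m Set.univ ^ s)
        (ENNReal.tendsto_pow_atTop_nhds_zero_of_lt_one (hP.rpow_lt_one hs))
        (Or.inr (ENNReal.mul_ne_top ENNReal.ofNat_ne_top hUs))) (Or.inr hosc.ne)
    rw [mul_zero, zero_mul] at hlim
    refine tendsto_of_tendsto_of_tendsto_of_le_of_le tendsto_const_nhds hlim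
      (fun _ => zero_le) fun n => ?_
    refine (hP.eLpNorm_sub_le_level hp hs hf (hsum n)).trans ?_
    gcongr
    exact le_lqNorm hq (fun k => (∑ Q ∈ P k, m Q ^ (-(s * p)) * osc m p f Q ^ p) ^ (1 / p)) n

end Converse

/-! ### Lipschitz composition and conclusion. -/

theorem enorm_comp_sub_le {g : ℂ → ℂ} {K : ℝ≥0} (hg : LipschitzWith K g) (z w : ℂ) :
    ‖g z - g w‖ₑ ≤ K * ‖z - w‖ₑ := by
  simpa only [edist_eq_enorm_sub] using hg z w

theorem osc_comp_le {m : Measure I} {p : ℝ} (hp : 0 < p) {g : ℂ → ℂ} {K : ℝ≥0}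
    (hg : LipschitzWith K g) (f : I → ℂ) (Q : Set I) :
    osc m p (g ∘ f) Q ≤ K * osc m p f Q := by
  rw [osc_eq_iInf_eLpNorm hp, osc_eq_iInf_eLpNorm hp, ENNReal.mul_iInf (by simp)]
  refine le_iInf fun b => (iInf_le _ (g b)).trans ?_
  exact eLpNorm_le_nnreal_smul_eLpNorm_of_ae_le_mul'
    (ae_of_all _ fun x => enorm_comp_sub_le hg (f x) b) _

theorem eLpNorm_comp_le {m : Measure I} {p : ℝ≥0∞} {g : ℂ → ℂ} {K : ℝ≥0}
    (hg : LipschitzWith K g) (hg0 : g 0 = 0) (f : I → ℂ) :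
    eLpNorm (g ∘ f) p m ≤ K * eLpNorm f p m :=
  eLpNorm_le_nnreal_smul_eLpNorm_of_ae_le_mul'
    (ae_of_all _ fun x => by simpa [hg0] using enorm_comp_sub_le hg (f x) 0) _

theorem oscNorm_comp_le {m : Measure I} {P : ℕ → Finset (Set I)} {s p : ℝ} {q : ℝ≥0∞}
    (hp : 0 < p) (hq : 1 ≤ q) {g : ℂ → ℂ} {K : ℝ≥0} (hg : LipschitzWith K g) (f : I → ℂ) :
    oscNorm m P s p q (g ∘ f) ≤ K * oscNorm m P s p q f := by
  rw [oscNorm, oscNorm, ← lqNorm_const_mul hq]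
  refine lqNorm_mono fun k => ?_
  rw [one_div, ENNReal.rpow_inv_le_iff hp, ENNReal.mul_rpow_of_nonneg _ _ hp.le,
    ENNReal.rpow_inv_rpow hp.ne', Finset.mul_sum]
  refine Finset.sum_le_sum fun Q _ => ?_
  rw [mul_left_comm, ← ENNReal.mul_rpow_of_nonneg _ _ hp.le]
  gcongr
  exact osc_comp_le hp hg f Q

theorem besovNorm_le_cost {m : Measure I} {P : ℕ → Finset (Set I)} {s p : ℝ} {q : ℝ≥0∞}
    {f : I → ℂ} {c : Set I → ℂ} {a : Set I → I → ℂ} (h : IsRepresentation m P s p q f c a) :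
    besovNorm m P s p q f ≤ cost P p q c :=
  sInf_le ⟨c, a, h, rfl⟩

/-- Composition with a Lipschitz map fixing `0` increases the optimal cost of a representation by
at most a constant factor. -/
theorem exists_cost_comp_le {m : Measure I} [IsFiniteMeasure m] {P : ℕ → Finset (Set I)}
    {l₁ l₂ s p : ℝ} {q : ℝ≥0∞} (hP : IsGoodGrid m P l₁ l₂) (hp : 1 ≤ p) (hq : 1 ≤ q) (hs : 0 < s)
    {g : ℂ → ℂ} {K : ℝ≥0} (hg : LipschitzWith K g) (hg0 : g 0 = 0) :
    ∃ C : ℝ≥0, ∀ f c a, MemLp f (ENNReal.ofReal p) m → IsRepresentation m P s p q f c a →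
      ∃ c' a', IsRepresentation m P s p q (g ∘ f) c' a' ∧ cost P p q c' ≤ C * cost P p q c := by
  have hp0 : 0 < p := by positivity
  have hU0 : m Set.univ ≠ 0 := (hP.measure_pos 0 _ (by simp [hP.level_zero])).ne'
  have hU : ∀ r : ℝ, m Set.univ ^ r ≠ ∞ := fun r =>
    ENNReal.rpow_ne_top_of_ne_zero hU0 (measure_ne_top m _)
  have hG : (1 - ENNReal.ofReal l₂ ^ s)⁻¹ ≠ ∞ :=
    ENNReal.inv_ne_top.2 (tsub_pos_of_lt (hP.rpow_lt_one hs)).ne'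
  have hl : 2 * ENNReal.ofReal l₁ ^ (-s) ≠ ∞ := ENNReal.mul_ne_top ENNReal.ofNat_ne_top
    (ENNReal.rpow_ne_top_of_ne_zero (by simpa using hP.pos) ENNReal.ofReal_ne_top)
  set A := m Set.univ ^ s * (1 - ENNReal.ofReal l₂ ^ s)⁻¹
  set G := (1 - ENNReal.ofReal l₂ ^ s)⁻¹
  set L := 2 * ENNReal.ofReal l₁ ^ (-s)
  have hAt : A ≠ ∞ := ENNReal.mul_ne_top (hU s) hG
  -- `A` and `G` bound the `L^p` norm and the oscillation by the cost; `m Set.univ ^ (-s)` and `L`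
  -- bound the new cost by these two quantities.
  have hD : m Set.univ ^ (-s) * (K * A) + L * (K * G) ≠ ∞ :=
    ENNReal.add_ne_top.2 ⟨ENNReal.mul_ne_top (hU _) (ENNReal.mul_ne_top ENNReal.coe_ne_top hAt),
      ENNReal.mul_ne_top hl (ENNReal.mul_ne_top ENNReal.coe_ne_top hG)⟩
  refine ⟨(m Set.univ ^ (-s) * (K * A) + L * (K * G)).toNNReal, fun f c a hf h => ?_⟩
  rw [ENNReal.coe_toNNReal hD]
  have hn := (eLpNorm_comp_le (p := ENNReal.ofReal p) (m := m) hg hg0 f).trans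
    (mul_le_mul_right (h.eLpNorm_le hP hp hq hs hf.1) (K : ℝ≥0∞))
  have ho := (oscNorm_comp_le (m := m) (P := P) (s := s) hp0 hq hg f).trans
    (mul_le_mul_right (h.oscNorm_le hP hp hq hs hf.1) (K : ℝ≥0∞))
  obtain ⟨c', a', h', hc'⟩ := hP.exists_isRepresentation hp hq hs (hg.comp_memLp hg0 hf)
    (ho.trans_lt (ENNReal.mul_lt_top ENNReal.coe_lt_top
      (ENNReal.mul_lt_top hG.lt_top h.cost_lt_top)))
  refine ⟨c', a', h', hc'.trans ?_⟩
  calc _ ≤ m Set.univ ^ (-s) * (K * (A * cost P p q c)) + L * (K * (G * cost P p q c)) := by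
        gcongr
    _ = _ := by ring

end BesovGrid

theorem proposition19p1 {I : Type*} [MeasurableSpace I] (m : Measure I) [IsFiniteMeasure m]
    (P : ℕ → Finset (Set I)) (l₁ l₂ : ℝ) (hP : BesovGrid.IsGoodGrid m P l₁ l₂)
    (s p : ℝ) (q : ℝ≥0∞) (hp : 1 ≤ p) (hq : 1 ≤ q) (hs : 0 < s) (hsp : s < 1 / p)
    (g : ℂ → ℂ) (K : ℝ≥0) (hg : LipschitzWith K g) (hg0 : g 0 = 0) :
    -- the map `f ↦ g ∘ f` is well defined on classes modulo null sets, and maps the space to itself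
    (∀ f f' : I → ℂ, f =ᵐ[m] f' → g ∘ f =ᵐ[m] g ∘ f') ∧
    (∀ f : I → ℂ, BesovGrid.MemBesov m P s p q f → BesovGrid.MemBesov m P s p q (g ∘ f)) ∧
    (∀ f : I → ℂ, MemLp f (ENNReal.ofReal p) m →
      eLpNorm (g ∘ f) (ENNReal.ofReal p) m + BesovGrid.oscNorm m P s p q (g ∘ f) ≤
        K * (eLpNorm f (ENNReal.ofReal p) m + BesovGrid.oscNorm m P s p q f)) ∧
    ∃ C : ℝ≥0, ∀ f : I → ℂ, BesovGrid.MemBesov m P s p q f →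
      BesovGrid.besovNorm m P s p q (g ∘ f) ≤ C * BesovGrid.besovNorm m P s p q f := by
  obtain ⟨C, hC⟩ := BesovGrid.exists_cost_comp_le (q := q) hP hp hq hs hg hg0
  refine ⟨fun f f' h => h.fun_comp g, fun f hf => ?_, fun f _ => ?_, C, fun f hf => ?_⟩
  · obtain ⟨hfp, c, a, h⟩ := hf
    obtain ⟨c', a', h', -⟩ := hC f c a hfp h
    exact ⟨hg.comp_memLp hg0 hfp, c', a', h'⟩
  · rw [mul_add]
    exact add_le_add (BesovGrid.eLpNorm_comp_le hg hg0 f)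
      (BesovGrid.oscNorm_comp_le (by positivity) hq hg f)
  · obtain ⟨hfp, c₀, a₀, h₀⟩ := hf
    -- Needed to move `C` inside the infimum when `C = 0`: over an empty family `0 * ∞ = 0` would
    -- differ from the infimum `∞`.
    have hne : Nonempty
        {t | ∃ c a, BesovGrid.IsRepresentation m P s p q f c a ∧ t = BesovGrid.cost P p q c} :=
      ⟨⟨_, c₀, a₀, h₀, rfl⟩⟩
    rw [BesovGrid.besovNorm.eq_1 m P s p q f, sInf_eq_iInf',
      ENNReal.mul_iInf' (by simp) fun _ => hne]
    refine le_iInf ?_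
    rintro ⟨_, c, a, h, rfl⟩
    obtain ⟨c', a', h', hle⟩ := hC f c a hfp h
    exact (BesovGrid.besovNorm_le_cost h').trans hle
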